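/- An access point serves $N$ clients over unreliable channels; time is slotted and a frame is one slot ($\tau=1$). At the beginning of each slot $t=0,1,2,\dots$ a fresh packet is available for every client, and the access point transmits the packet of exactly one client, chosen on the basis of the information $\mathcal F_t$ available at the beginning of slot $t$. Given $\mathcal F_t$, a transmission to client $j$ succeeds with probability $p_j$, where $0<p_j\le 1$; packets that are not delivered in their slot are dropped. Let $q_j>0$ be the required timely throughput of client $j$, and assume that $\sum_{j=1}^N q_j/p_j=1$. Let $$d_j(t)=t\,q_j-\#\{\text{packets of client } j \text{ delivered in the slots } 0,\dots,t-1\}$$ be the debt of client $j$, and put $$\phi(t)=\sqrt{2t\log\log t},\qquad c_j=\frac{q_j(1-p_j)}{p_j^2}.$$ Suppose that the access point uses the maximum weighted debt first (MWDF) policy: in every slot $t$ it serves a client $j$ that maximizes $d_j(t)/p_j$, ties being broken arbitrarily (on the basis of $\mathcal F_t$). Then, almost surely, for every $j=1,\dots,N$, $$\limsup_{t\to\infty}\frac{d_j(t)}{\phi(t)}\;\le\;p_j\,\frac{\sum_{k=1}^N\sqrt{c_k}}{N}.$$ -/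

import Mathlib

open MeasureTheory ProbabilityTheory Filter

/-- The normalisation `φ(t) = √(2 t log log t)` of the law of the iterated logarithm. -/
noncomputable def phi (t : ℕ) : ℝ :=
  Real.sqrt (2 * (t : ℝ) * Real.log (Real.log (t : ℝ)))

/-- The constant `c = q (1 - p) / p ^ 2` of a client with channel reliability `p` and required
timely throughput `q`. -/
noncomputable def lilConst (p q : ℝ) : ℝ := q * (1 - p) / p ^ 2

/-- An access point with `N` clients and frames of one slot. Slot `t` is frame `t`; every client
has a fresh packet at its beginning, and one packet is transmitted in it.
`served t ω` is the client attempted in slot `t`, and `success t` is the event that this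
transmission succeeds. The σ-algebra `ℱ t` is the information available at the beginning of
slot `t`: the choice of client may use that information only, and, given it, the transmission
succeeds with the reliability of the channel of the chosen client. -/
structure IsSlottedNetwork {Ω : Type*} [mΩ : MeasurableSpace Ω] (μ : Measure Ω)
    (ℱ : Filtration ℕ mΩ) {N : ℕ} (p : Fin N → ℝ)
    (served : ℕ → Ω → Fin N) (success : ℕ → Set Ω) : Prop where
  served_measurable : ∀ t, Measurable[ℱ t] (served t)
  success_measurable : ∀ t, MeasurableSet[ℱ (t + 1)] (success t)
  success_prob : ∀ t,
    μ[(success t).indicator (fun _ => (1 : ℝ)) | ℱ t] =ᵐ[μ] fun ω => p (served t ω)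

/-- The event that a packet of client `j` is delivered in slot `t`. -/
def deliveredTo {Ω : Type*} {N : ℕ} (served : ℕ → Ω → Fin N) (success : ℕ → Set Ω)
    (j : Fin N) (t : ℕ) : Set Ω :=
  {ω | served t ω = j ∧ ω ∈ success t}

/-- The debt of client `j` at the beginning of frame `t`: `t q_j` minus the number of its packets
delivered in the frames `0, …, t - 1`. -/
noncomputable def debt {Ω : Type*} {N : ℕ} (q : Fin N → ℝ) (served : ℕ → Ω → Fin N)
    (success : ℕ → Set Ω) (j : Fin N) (t : ℕ) (ω : Ω) : ℝ :=
  (t : ℝ) * q j -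
    ∑ l ∈ Finset.range t, (deliveredTo served success j l).indicator (fun _ => (1 : ℝ)) ω

/-- The maximum weighted debt first policy: in every slot the client served has the largest value
of `d_j(t) / p_j`. Ties may be broken in any way. -/
def IsMWDF {Ω : Type*} {N : ℕ} (p q : Fin N → ℝ) (served : ℕ → Ω → Fin N)
    (success : ℕ → Set Ω) : Prop :=
  ∀ (t : ℕ) (ω : Ω) (k : Fin N),
    debt q served success k t ω / p k ≤
      debt q served success (served t ω) t ω / p (served t ω)

/-! Divide each debt by its p_j. As Σ q_j/p_j = 1, the sum S of the weighted debts moves in each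
slot by the centred noise 1 - 1_success/p of the client served, so S is a martingale under any
policy (`sum_debt_div`). MWDF keeps every weighted debt at most o(φ) above the average S/N: an
exponential Lyapunov function has bounded mean, so the excesses are at most O(log t)
(`ae_eventually_excess_le`). Hence d_j is at most p_j S/N up to o(φ), and an iterated-logarithm
bound for S suffices.

That bound comes from an exponential supermartingale, Ville's inequality and Borel–Cantelli along
geometric blocks (`ae_eventually_noiseSum_le`). It needs the quadratic variation of S, hence the
shares of slots. The collapse and crude o(t) bounds on the noise show that client j gets
asymptotically at most the share q_j/p_j (`ae_eventually_attempts_le`), so the variation grows at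
rate at most Σ c_k. The outcome is p_j √(Σ c_k)/N, which is at most the required constant. -/

/-! ### Conditional drift over one slot and Ville's inequality -/

section OneStep

variable {Ω : Type*} [mΩ : MeasurableSpace Ω] {μ : Measure Ω}
  {ℱ : Filtration ℕ mΩ} {N : ℕ} {p : Fin N → ℝ} {served : ℕ → Ω → Fin N} {success : ℕ → Set Ω}

theorem IsSlottedNetwork.measurable_comp_served
    (network : IsSlottedNetwork μ ℱ p served success) (t : ℕ) (g : Fin N → ℝ) :
    Measurable[ℱ t] fun ω => g (served t ω) :=
  (measurable_of_finite g).comp (network.served_measurable t)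

variable [IsProbabilityMeasure μ]

theorem IsSlottedNetwork.integrable_comp_served
    (network : IsSlottedNetwork μ ℱ p served success) (t : ℕ) (g : Fin N → ℝ) :
    Integrable (fun ω => g (served t ω)) μ := by
  refine Integrable.of_bound
    ((network.measurable_comp_served t g).mono (ℱ.le t) le_rfl).aestronglyMeasurable
    (∑ k, |g k|) (.of_forall fun ω => ?_)
  exact Finset.single_le_sum (f := fun k => |g k|) (fun k _ => abs_nonneg _)
    (Finset.mem_univ (served t ω))

/-- Given the past, a transmission may be replaced by its success probability. -/
theorem IsSlottedNetwork.integral_mul_success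
    (network : IsSlottedNetwork μ ℱ p served success) (t : ℕ) {g : Ω → ℝ}
    (hg : Measurable[ℱ t] g) (hgi : Integrable g μ) :
    ∫ ω, g ω * (success t).indicator (fun _ => (1 : ℝ)) ω ∂μ =
      ∫ ω, g ω * p (served t ω) ∂μ := by
  have hs : MeasurableSet (success t) := ℱ.le (t + 1) _ (network.success_measurable t)
  have hi : Integrable ((success t).indicator fun _ => (1 : ℝ)) μ :=
    (integrable_const 1).indicator hs
  have hgm : Integrable (g * (success t).indicator fun _ => (1 : ℝ)) μ := by
    refine hgi.mul_bdd (c := 1) hi.aestronglyMeasurable (.of_forall fun ω => ?_)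
    by_cases h : ω ∈ success t <;> simp [h]
  have h1 := condExp_mul_of_stronglyMeasurable_left (μ := μ) (m := ℱ t)
    hg.stronglyMeasurable hgm hi
  calc ∫ ω, g ω * (success t).indicator (fun _ => (1 : ℝ)) ω ∂μ
      = ∫ ω, (μ[g * (success t).indicator (fun _ => (1 : ℝ)) | ℱ t]) ω ∂μ :=
        (integral_condExp (ℱ.le t)).symm
    _ = ∫ ω, g ω * p (served t ω) ∂μ := by
        refine integral_congr_ae ?_
        filter_upwards [h1, network.success_prob t] with ω h1 h2
        rw [h1, Pi.mul_apply, h2]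

/-- The drift inequality over one slot: `f₁` and `f₀` bound the new value after a success and after
a failure. -/
theorem IsSlottedNetwork.setIntegral_le_of_step
    (network : IsSlottedNetwork μ ℱ p served success) (t : ℕ) {f f₀ f₁ h : Ω → ℝ}
    (hf₀ : Measurable[ℱ t] f₀) (hf₁ : Measurable[ℱ t] f₁)
    (hf : Integrable f μ) (hi₀ : Integrable f₀ μ) (hi₁ : Integrable f₁ μ) (hi : Integrable h μ)
    (hsucc : ∀ ω ∈ success t, f ω ≤ f₁ ω) (hfail : ∀ ω ∉ success t, f ω ≤ f₀ ω)
    (hstep : ∀ ω, p (served t ω) * f₁ ω + (1 - p (served t ω)) * f₀ ω ≤ h ω)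
    {B : Set Ω} (hB : MeasurableSet[ℱ t] B) :
    ∫ ω in B, f ω ∂μ ≤ ∫ ω in B, h ω ∂μ := by
  have hBm : MeasurableSet B := ℱ.le t _ hB
  have hs : MeasurableSet (success t) := ℱ.le (t + 1) _ (network.success_measurable t)
  have hpb : ∀ᵐ ω ∂μ, ‖p (served t ω)‖ ≤ ∑ k, |p k| := .of_forall fun ω =>
    Finset.single_le_sum (f := fun k => |p k|) (fun k _ => abs_nonneg _)
      (Finset.mem_univ (served t ω))
  have hpm := (network.integrable_comp_served t p).aestronglyMeasurable
  have hdi : Integrable (fun ω => f₁ ω - f₀ ω) μ := hi₁.sub hi₀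
  have hdA : Integrable
      (fun ω => (f₁ ω - f₀ ω) * (success t).indicator (fun _ => (1 : ℝ)) ω) μ := by
    refine hdi.mul_bdd (c := 1)
      ((integrable_const (1 : ℝ)).indicator hs).aestronglyMeasurable (.of_forall fun ω => ?_)
    by_cases h : ω ∈ success t <;> simp [h]
  have hdp : Integrable (fun ω => (f₁ ω - f₀ ω) * p (served t ω)) μ := hdi.mul_bdd hpm hpb
  have key : ∫ ω in B, (f₁ ω - f₀ ω) * (success t).indicator (fun _ => (1 : ℝ)) ω ∂μ =
      ∫ ω in B, (f₁ ω - f₀ ω) * p (served t ω) ∂μ := by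
    have := network.integral_mul_success t (g := B.indicator fun ω => f₁ ω - f₀ ω)
      ((hf₁.sub hf₀).indicator hB) (hdi.indicator hBm)
    rw [← integral_indicator hBm, ← integral_indicator hBm]
    simpa only [Set.indicator_mul_left] using this
  calc ∫ ω in B, f ω ∂μ
      ≤ ∫ ω in B,
          (f₀ ω + (f₁ ω - f₀ ω) * (success t).indicator (fun _ => (1 : ℝ)) ω) ∂μ := by
        refine setIntegral_mono hf.integrableOn (hi₀.add hdA).integrableOn fun ω => ?_
        by_cases h : ω ∈ success t
        · simpa [h] using hsucc ω h
        · simpa [h] using hfail ω h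
    _ = ∫ ω in B, (f₀ ω + (f₁ ω - f₀ ω) * p (served t ω)) ∂μ := by
        rw [integral_add hi₀.integrableOn hdA.integrableOn, key,
          integral_add hi₀.integrableOn hdp.integrableOn]
    _ ≤ ∫ ω in B, h ω ∂μ := by
        refine setIntegral_mono (hi₀.add hdp).integrableOn hi.integrableOn fun ω => ?_
        have := hstep ω
        simp only
        linarith

/-- Ville's maximal inequality. -/
theorem mul_measureReal_exists_ge_le {Z : ℕ → Ω → ℝ} (hZ : ∀ t, Measurable[ℱ t] (Z t))
    (hi : ∀ t, Integrable (Z t) μ) (hnn : ∀ t ω, 0 ≤ Z t ω)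
    (hstep : ∀ t (B : Set Ω), MeasurableSet[ℱ t] B →
      ∫ ω in B, Z (t + 1) ω ∂μ ≤ ∫ ω in B, Z t ω ∂μ) {a : ℝ} (ha : 0 < a) :
    μ {ω | ∃ t, a ≤ Z t ω} ≤ ENNReal.ofReal ((∫ ω, Z 0 ω ∂μ) / a) := by
  set C : ℕ → Set Ω := fun n => {ω | ∃ t ≤ n, a ≤ Z t ω} with hC
  have hCm : ∀ n, MeasurableSet[ℱ n] (C n) := fun n => by
    have : C n = ⋃ t ∈ Set.Iic n, {ω | a ≤ Z t ω} := by ext; simp [hC]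
    rw [this]
    refine MeasurableSet.biUnion (Set.to_countable _) fun t ht => ?_
    exact ℱ.mono ht _ (measurableSet_le measurable_const (hZ t))
  have hCm' : ∀ n, MeasurableSet (C n) := fun n => ℱ.le n _ (hCm n)
  have hmono : Monotone C := fun m n hmn ω ⟨t, ht, h⟩ => ⟨t, ht.trans hmn, h⟩
  have hdisj : ∀ n (f : Ω → ℝ), Integrable f μ → ∫ ω in (C n)ᶜ, f ω ∂μ =
      ∫ ω in C (n + 1) \ C n, f ω ∂μ + ∫ ω in (C (n + 1))ᶜ, f ω ∂μ := fun n f hf => by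
    rw [← setIntegral_union _ (hCm' _).compl hf.integrableOn hf.integrableOn]
    · congr 2
      ext ω
      have := @hmono n (n + 1) (by omega) ω
      simp only [Set.mem_compl_iff, Set.mem_union, Set.mem_sdiff]
      tauto
    · exact Set.disjoint_left.2 fun ω h h' => h' h.1
  -- Mass that has reached level a is frozen at a. The supermartingale step is used only on the
  -- event, known at time n, that the level has not yet been reached.
  have hmain : ∀ n, a * μ.real (C n) + ∫ ω in (C n)ᶜ, Z n ω ∂μ ≤ ∫ ω, Z 0 ω ∂μ := by
    intro n
    induction n with
    | zero =>
      have h0 : a * μ.real (C 0) ≤ ∫ ω in C 0, Z 0 ω ∂μ := by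
        rw [mul_comm, ← smul_eq_mul, ← setIntegral_const]
        refine setIntegral_mono_on (integrable_const a).integrableOn (hi 0).integrableOn
          (hCm' 0) fun ω ⟨t, ht, h⟩ => ?_
        rwa [Nat.le_zero.1 ht] at h
      rw [← integral_add_compl (hCm' 0) (hi 0)]
      linarith
    | succ n ih =>
      have h1 : a * μ.real (C (n + 1) \ C n) ≤ ∫ ω in C (n + 1) \ C n, Z (n + 1) ω ∂μ := by
        rw [mul_comm, ← smul_eq_mul, ← setIntegral_const]
        refine setIntegral_mono_on (integrable_const a).integrableOn (hi _).integrableOn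
          ((hCm' _).diff (hCm' _)) fun ω hω => ?_
        obtain ⟨⟨t, ht, h⟩, h'⟩ := hω
        rcases Nat.le_succ_iff.1 ht with h2 | h2
        · exact absurd ⟨t, h2, h⟩ h'
        · rwa [h2] at h
      have h2 := hstep n _ (hCm n).compl
      rw [hdisj n _ (hi (n + 1))] at h2
      have h3 : μ.real (C (n + 1)) = μ.real (C (n + 1) \ C n) + μ.real (C n) :=
        (measureReal_sdiff_add_inter (hCm' n)).symm.trans
          (by rw [Set.inter_eq_right.2 (hmono (Nat.le_succ n))])
      rw [h3]
      linarith
  have hU : {ω | ∃ t, a ≤ Z t ω} = ⋃ n, C n := by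
    ext ω
    simp only [hC, Set.mem_ofPred_eq, Set.mem_iUnion]
    exact ⟨fun ⟨t, h⟩ => ⟨t, t, le_rfl, h⟩, fun ⟨_, t, _, h⟩ => ⟨t, h⟩⟩
  rw [hU, hmono.measure_iUnion]
  refine iSup_le fun n => ?_
  rw [← ofReal_measureReal]
  refine ENNReal.ofReal_le_ofReal ?_
  rw [le_div_iff₀ ha]
  have := hmain n
  have h0 : 0 ≤ ∫ ω in (C n)ᶜ, Z n ω ∂μ := integral_nonneg fun ω => hnn n ω
  linarith

end OneStep

/-! ### Exponential moments, geometric blocks, Borel–Cantelli -/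

/-- The cubic Taylor remainder is absorbed into the quadratic term. The coefficient tends to 1/2 as
δ → 0, which keeps the constant of the iterated logarithm sharp. -/
theorem exp_le_quadratic {x δ : ℝ} (hx : |x| ≤ δ) (hδ : δ ≤ 1) :
    Real.exp x ≤ 1 + x + (1 + δ) / 2 * x ^ 2 := by
  have h := le_of_abs_le (Real.exp_bound (hx.trans hδ) (n := 3) (by norm_num))
  norm_num [Finset.sum_range_succ, Nat.factorial] at h
  have h2 : |x| ^ 3 ≤ δ * x ^ 2 := by
    rw [pow_succ', sq_abs]
    exact mul_le_mul_of_nonneg_right hx (sq_nonneg x)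
  have h3 : 0 ≤ |x| ^ 3 := by positivity
  linarith

/-- Bound for the moment generating function of `c (1 - 1_A / p)`, where `A` has probability `p`. -/
theorem exp_noise_moment_le {p c δ : ℝ} (hp : 0 < p) (hp1 : p ≤ 1) (hδ : δ ≤ 1)
    (hc : |c| ≤ δ) (hc' : |c * (1 - 1 / p)| ≤ δ) :
    p * Real.exp (c * (1 - 1 / p)) + (1 - p) * Real.exp c ≤
      Real.exp ((1 + δ) / 2 * (c ^ 2 * ((1 - p) / p))) := by
  have h1 := mul_le_mul_of_nonneg_left (exp_le_quadratic hc' hδ) hp.le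
  have h2 := mul_le_mul_of_nonneg_left (exp_le_quadratic hc hδ) (sub_nonneg.2 hp1)
  have h3 := Real.add_one_le_exp ((1 + δ) / 2 * (c ^ 2 * ((1 - p) / p)))
  -- The noise is centred, so the linear terms cancel; its variance is (1 - p) / p.
  have h4 : p * (1 + c * (1 - 1 / p) + (1 + δ) / 2 * (c * (1 - 1 / p)) ^ 2) +
      (1 - p) * (1 + c + (1 + δ) / 2 * c ^ 2) =
      (1 + δ) / 2 * (c ^ 2 * ((1 - p) / p)) + 1 := by
    field_simp
    ring
  linarith

/-- The deterministic part of the law of the iterated logarithm: linear bounds with slopes adapted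
to geometric blocks of time. -/
theorem eventually_le_phi_of_blocks {S V : ℕ → ℝ} {s δ : ℝ} (hs : 0 < s) (hδ : 0 < δ)
    (hV : ∀ᶠ t : ℕ in atTop, V t ≤ s ^ 2 * t)
    (hblock : ∀ᶠ k : ℕ in atTop, ∀ t,
      √(2 * Real.log k / (1 + δ) ^ k) / s * S t -
        (1 + δ) / 2 * ((√(2 * Real.log k / (1 + δ) ^ k) / s) ^ 2 * V t) <
      (1 + δ) * Real.log k) :
    ∀ᶠ t : ℕ in atTop, S t ≤ (1 + δ) ^ 3 * s * phi t := by
  have hlogθ : 0 < Real.log (1 + δ) := Real.log_pos (by linarith)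
  -- This threshold lets δ log k absorb the constant log log (1 + δ), which may be negative.
  have hlog : ∀ᶠ k : ℕ in atTop, -(1 + δ) * Real.log (Real.log (1 + δ)) / δ ≤ Real.log k :=
    (Real.tendsto_log_atTop.comp tendsto_natCast_atTop_atTop).eventually_ge_atTop _
  obtain ⟨K, hK⟩ := eventually_atTop.1 (hblock.and (hlog.and (eventually_ge_atTop 2)))
  have ht : ∀ᶠ t : ℕ in atTop, (1 + δ) ^ (K + 1) ≤ (t : ℝ) :=
    tendsto_natCast_atTop_atTop.eventually_ge_atTop _
  filter_upwards [hV, ht, eventually_ge_atTop 1] with t hVt htK ht1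
  have ht1' : (1 : ℝ) ≤ t := by exact_mod_cast ht1
  obtain ⟨k, hk1, hk2⟩ := exists_nat_pow_near ht1' (by linarith : 1 < 1 + δ)
  have hkK : K ≤ k := by
    have := (pow_lt_pow_iff_right₀ (by linarith : 1 < 1 + δ)).1 (htK.trans_lt hk2)
    omega
  obtain ⟨hb, hl, hk⟩ := hK k hkK
  have hk' : (1 : ℝ) < k := by exact_mod_cast (by omega : 1 < k)
  have hlk : 0 < Real.log k := Real.log_pos hk'
  specialize hb t
  set m := √(2 * Real.log k / (1 + δ) ^ k) with hm
  have hP : 0 < (1 + δ) ^ k := by positivity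
  have hmpos : 0 < m := Real.sqrt_pos.2 (by positivity)
  have hm2 : m ^ 2 * (1 + δ) ^ k = 2 * Real.log k := by
    rw [hm, Real.sq_sqrt (by positivity)]
    field_simp
  -- The slope makes the level term and the variance term equal at time (1 + δ)^k. One factor 1 + δ
  -- is inherited from the hypothesis, one pays for t inside the block; `hphi` costs the third.
  have hS : S t ≤ (1 + δ) ^ 2 * s * (m * (1 + δ) ^ k) := by
    have h1 : (m / s) ^ 2 * V t ≤ m ^ 2 * t :=
      calc (m / s) ^ 2 * V t ≤ (m / s) ^ 2 * (s ^ 2 * t) := by gcongr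
        _ = m ^ 2 * t := by field_simp
    have h2 : m / s * S t ≤ (1 + δ) / 2 * m ^ 2 * (t + (1 + δ) ^ k) := by
      have := mul_le_mul_of_nonneg_left h1 (by positivity : 0 ≤ (1 + δ) / 2)
      have h3 : (1 + δ) / 2 * (m ^ 2 * (1 + δ) ^ k) = (1 + δ) * Real.log k := by
        rw [hm2]; ring
      linarith
    have h3 : (t : ℝ) + (1 + δ) ^ k ≤ 2 * (1 + δ) * (1 + δ) ^ k := by
      rw [pow_succ] at hk2
      nlinarith
    have h4 : m / s * S t ≤ m / s * ((1 + δ) ^ 2 * s * (m * (1 + δ) ^ k)) :=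
      calc m / s * S t ≤ (1 + δ) / 2 * m ^ 2 * (2 * (1 + δ) * (1 + δ) ^ k) := h2.trans (by gcongr)
        _ = m / s * ((1 + δ) ^ 2 * s * (m * (1 + δ) ^ k)) := by field_simp
    exact le_of_mul_le_mul_left h4 (by positivity)
  have hphi : m * (1 + δ) ^ k ≤ (1 + δ) * phi t := by
    have hlt : k * Real.log (1 + δ) ≤ Real.log t := by
      rw [← Real.log_pow]
      exact Real.log_le_log hP hk1
    have hll : Real.log k + Real.log (Real.log (1 + δ)) ≤ Real.log (Real.log t) := by
      rw [← Real.log_mul (by positivity) hlogθ.ne']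
      exact Real.log_le_log (by positivity) hlt
    have hl' : Real.log k ≤ (1 + δ) * Real.log (Real.log t) := by
      rw [div_le_iff₀ hδ] at hl
      nlinarith
    have hll0 : 0 ≤ Real.log (Real.log t) := by
      by_contra! h
      nlinarith
    refine le_of_sq_le_sq ?_ (mul_nonneg (by positivity) (Real.sqrt_nonneg _))
    rw [mul_pow (1 + δ), phi, Real.sq_sqrt (by positivity)]
    calc (m * (1 + δ) ^ k) ^ 2 = 2 * Real.log k * (1 + δ) ^ k := by rw [← hm2]; ring
      _ ≤ 2 * ((1 + δ) * Real.log (Real.log t)) * t := by gcongr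
      _ = (1 + δ) * (2 * t * Real.log (Real.log t)) := by ring
      _ ≤ (1 + δ) ^ 2 * (2 * t * Real.log (Real.log t)) := by
        gcongr
        nlinarith
  calc S t ≤ (1 + δ) ^ 2 * s * (m * (1 + δ) ^ k) := hS
    _ ≤ (1 + δ) ^ 2 * s * ((1 + δ) * phi t) := by gcongr
    _ = (1 + δ) ^ 3 * s * phi t := by ring

/-- Borel–Cantelli, with the finitely many events that lack a bound replaced by ∅. -/
theorem ae_eventually_notMem_of_summable {Ω : Type*} {mΩ : MeasurableSpace Ω} {μ : Measure Ω}
    {E : ℕ → Set Ω} {u : ℕ → ℝ} (hu : Summable u)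
    (hE : ∀ᶠ k in atTop, μ (E k) ≤ ENNReal.ofReal (u k)) :
    ∀ᵐ ω ∂μ, ∀ᶠ k in atTop, ω ∉ E k := by
  obtain ⟨K, hK⟩ := eventually_atTop.1 hE
  have hsum : ∑' k, μ (if K ≤ k then E k else ∅) ≠ ⊤ := by
    refine ne_top_of_le_ne_top hu.tsum_ofReal_ne_top (ENNReal.tsum_le_tsum fun k => ?_)
    by_cases h : K ≤ k
    · simpa [h] using hK k h
    · simp [h]
  filter_upwards [ae_eventually_notMem hsum] with ω hω
  filter_upwards [hω, eventually_ge_atTop K] with k hk hkK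
  simpa [hkK] using hk

/-! ### Upper law of the iterated logarithm for the noise -/

section Noise

variable {Ω : Type*} {N : ℕ}

/-- The normalised transmission noise `1 - 1_success / p` of slot `t`. -/
noncomputable def noise (p : Fin N → ℝ) (served : ℕ → Ω → Fin N) (success : ℕ → Set Ω)
    (t : ℕ) (ω : Ω) : ℝ :=
  1 - (success t).indicator (fun _ => (1 : ℝ)) ω / p (served t ω)

/-- The martingale transform of the noise by the weight `a` of the client served. -/
noncomputable def noiseSum (p : Fin N → ℝ) (served : ℕ → Ω → Fin N) (success : ℕ → Set Ω)
    (a : Fin N → ℝ) (t : ℕ) (ω : Ω) : ℝ :=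
  ∑ l ∈ Finset.range t, a (served l ω) * noise p served success l ω

/-- The predictable quadratic variation of `noiseSum`. -/
noncomputable def noiseVar (p : Fin N → ℝ) (served : ℕ → Ω → Fin N)
    (a : Fin N → ℝ) (t : ℕ) (ω : Ω) : ℝ :=
  ∑ l ∈ Finset.range t, a (served l ω) ^ 2 * ((1 - p (served l ω)) / p (served l ω))

variable [mΩ : MeasurableSpace Ω] {μ : Measure Ω}
  {ℱ : Filtration ℕ mΩ} {p : Fin N → ℝ} {served : ℕ → Ω → Fin N} {success : ℕ → Set Ω}

theorem IsSlottedNetwork.measurable_noise (network : IsSlottedNetwork μ ℱ p served success)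
    (t : ℕ) : Measurable[ℱ (t + 1)] (noise p served success t) :=
  measurable_const.sub ((measurable_const.indicator (network.success_measurable t)).div
    ((network.measurable_comp_served t p).mono (ℱ.mono t.le_succ) le_rfl))

theorem IsSlottedNetwork.measurable_noiseSum (network : IsSlottedNetwork μ ℱ p served success)
    (a : Fin N → ℝ) (t : ℕ) : Measurable[ℱ t] (noiseSum p served success a t) := by
  refine Finset.measurable_fun_sum _ fun l hl => ?_
  have hl : l + 1 ≤ t := Finset.mem_range.1 hl
  exact ((network.measurable_comp_served l a).mono (ℱ.mono (by omega)) le_rfl).mul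
    ((network.measurable_noise l).mono (ℱ.mono hl) le_rfl)

theorem IsSlottedNetwork.measurable_noiseVar (network : IsSlottedNetwork μ ℱ p served success)
    (a : Fin N → ℝ) (t : ℕ) : Measurable[ℱ t] (noiseVar p served a t) := by
  refine Finset.measurable_fun_sum _ fun l hl => ?_
  exact (network.measurable_comp_served l fun k => a k ^ 2 * ((1 - p k) / p k)).mono
    (ℱ.mono (Finset.mem_range.1 hl).le) le_rfl

variable [IsProbabilityMeasure μ]

/-- The exponential supermartingale of `noiseSum`. -/
theorem IsSlottedNetwork.measure_exists_exp_le
    (network : IsSlottedNetwork μ ℱ p served success) (hp : ∀ j, 0 < p j) (hp1 : ∀ j, p j ≤ 1)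
    {a : Fin N → ℝ} {r δ : ℝ} (hδ : δ ≤ 1) (hr : ∀ k, |r * a k| ≤ δ)
    (hr' : ∀ k, |r * a k * (1 - 1 / p k)| ≤ δ) (x : ℝ) :
    μ {ω | ∃ t, x ≤ r * noiseSum p served success a t ω -
      (1 + δ) / 2 * (r ^ 2 * noiseVar p served a t ω)} ≤ ENNReal.ofReal (Real.exp (-x)) := by
  set Z : ℕ → Ω → ℝ := fun t ω => Real.exp (r * noiseSum p served success a t ω -
      (1 + δ) / 2 * (r ^ 2 * noiseVar p served a t ω)) with hZ
  have hZm : ∀ t, Measurable[ℱ t] (Z t) := fun t => Real.measurable_exp.comp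
    (((network.measurable_noiseSum a t).const_mul _).sub
      (((network.measurable_noiseVar a t).const_mul _).const_mul _))
  -- The factor gained by Z when client k is served, for success (b = 1) or failure (b = 0).
  set G : ℝ → Fin N → ℝ := fun b k => Real.exp (r * a k * (1 - b / p k) -
    (1 + δ) / 2 * ((r * a k) ^ 2 * ((1 - p k) / p k))) with hG
  have hsucc : ∀ t, ∀ ω ∈ success t, Z (t + 1) ω = Z t ω * G 1 (served t ω) := by
    intro t ω h
    simp only [hZ, hG, noiseSum, noiseVar, noise, Finset.sum_range_succ, ← Real.exp_add,
      Set.indicator_of_mem h]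
    congr 1
    ring
  have hfail : ∀ t, ∀ ω ∉ success t, Z (t + 1) ω = Z t ω * G 0 (served t ω) := by
    intro t ω h
    simp only [hZ, hG, noiseSum, noiseVar, noise, Finset.sum_range_succ, ← Real.exp_add,
      Set.indicator_of_notMem h]
    congr 1
    ring
  have hprod : ∀ t b, Integrable (Z t) μ →
      Integrable (fun ω => Z t ω * G b (served t ω)) μ := fun t b h =>
    h.mul_bdd (network.integrable_comp_served t (G b)).aestronglyMeasurable
      (.of_forall fun ω => Finset.single_le_sum (f := fun k => ‖G b k‖)
        (fun k _ => norm_nonneg _) (Finset.mem_univ (served t ω)))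
  have hint : ∀ t, Integrable (Z t) μ := by
    intro t
    induction t with
    | zero => simp [hZ, noiseSum, noiseVar]
    | succ t ih =>
      refine ((hprod t 1 ih).add (hprod t 0 ih)).mono'
        ((hZm (t + 1)).mono (ℱ.le _) le_rfl).aestronglyMeasurable (.of_forall fun ω => ?_)
      have h0 : ∀ b, 0 ≤ Z t ω * G b (served t ω) := fun b =>
        mul_nonneg (Real.exp_nonneg _) (Real.exp_nonneg _)
      rw [Real.norm_of_nonneg (Real.exp_nonneg _)]
      by_cases h : ω ∈ success t
      · exact (hsucc t ω h).le.trans (le_add_of_nonneg_right (h0 0))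
      · exact (hfail t ω h).le.trans (le_add_of_nonneg_left (h0 1))
  have hGm : ∀ t b, Measurable[ℱ t] fun ω => Z t ω * G b (served t ω) := fun t b =>
    (hZm t).mul (network.measurable_comp_served t (G b))
  have hville := mul_measureReal_exists_ge_le (μ := μ) hZm hint
    (fun t ω => (Real.exp_pos _).le) (fun t B hB => network.setIntegral_le_of_step t
      (hGm t 0) (hGm t 1) (hint (t + 1)) (hprod t 0 (hint t)) (hprod t 1 (hint t)) (hint t)
      (fun ω h => (hsucc t ω h).le) (fun ω h => (hfail t ω h).le) (fun ω => ?_) hB)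
    (Real.exp_pos x)
  · have h0 : ∫ ω, Z 0 ω ∂μ = 1 := by simp [hZ, noiseSum, noiseVar]
    rw [h0, one_div, ← Real.exp_neg] at hville
    simpa only [hZ, Real.exp_le_exp] using hville
  · set k := served t ω
    have h1 := exp_noise_moment_le (hp k) (hp1 k) hδ (hr k) (hr' k)
    have h2 : p k * G 1 k + (1 - p k) * G 0 k ≤ 1 := by
      simp only [hG, Real.exp_sub, zero_div, sub_zero, mul_one]
      rw [← mul_div_assoc (p k), ← mul_div_assoc (1 - p k), ← add_div]
      exact div_le_one_of_le₀ h1 (Real.exp_nonneg _)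
    have h3 : 0 ≤ Z t ω := Real.exp_nonneg _
    nlinarith

/-- The upper half of the law of the iterated logarithm for `noiseSum`. -/
theorem IsSlottedNetwork.ae_eventually_noiseSum_le
    (network : IsSlottedNetwork μ ℱ p served success) (hp : ∀ j, 0 < p j) (hp1 : ∀ j, p j ≤ 1)
    (a : Fin N → ℝ) {s δ : ℝ} (hs : 0 < s) (hδ : 0 < δ) (hδ1 : δ ≤ 1) :
    ∀ᵐ ω ∂μ, (∀ᶠ t : ℕ in atTop, noiseVar p served a t ω ≤ s ^ 2 * t) →
      ∀ᶠ t : ℕ in atTop, noiseSum p served success a t ω ≤ (1 + δ) ^ 3 * s * phi t := by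
  set r : ℕ → ℝ := fun k => √(2 * Real.log k / (1 + δ) ^ k) / s with hr
  have hr0 : Tendsto r atTop (nhds 0) := by
    have h1 : Tendsto (fun k : ℕ => (k : ℝ) * ((1 + δ)⁻¹) ^ k) atTop (nhds 0) :=
      tendsto_self_mul_const_pow_of_lt_one (by positivity) (inv_lt_one_of_one_lt₀ (by linarith))
    have h2 : Tendsto (fun k : ℕ => 2 * Real.log k / (1 + δ) ^ k) atTop (nhds 0) := by
      refine squeeze_zero (fun k => ?_) (fun k => ?_) (by simpa using h1.const_mul 2)
      · have := Real.log_natCast_nonneg k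
        positivity
      · have := Real.log_le_self (Nat.cast_nonneg (α := ℝ) k)
        rw [← div_eq_mul_inv, ← mul_div_assoc]
        gcongr
    simpa using (Real.continuous_sqrt.tendsto 0).comp h2 |>.div_const s
  have hsmall : ∀ c : ℝ, ∀ᶠ k in atTop, |r k * c| ≤ δ := fun c => by
    have : Tendsto (fun k => |r k * c|) atTop (nhds 0) := by simpa using (hr0.mul_const c).abs
    exact this.eventually_le_const hδ
  -- The level (1 + δ) log k turns Ville's bound exp(-x) into the summable k^(-(1 + δ)). Since r k →
  -- 0, the smallness conditions hold for large k.
  have hE : ∀ᶠ k : ℕ in atTop,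
      μ {ω | ∃ t, (1 + δ) * Real.log k ≤ r k * noiseSum p served success a t ω -
        (1 + δ) / 2 * ((r k) ^ 2 * noiseVar p served a t ω)} ≤
      ENNReal.ofReal ((k : ℝ) ^ (-(1 + δ))) := by
    filter_upwards [eventually_all.2 fun j => hsmall (a j),
      eventually_all.2 fun j => hsmall (a j * (1 - 1 / p j)), eventually_gt_atTop 0]
      with k h1 h2 hk
    have := network.measure_exists_exp_le hp hp1 hδ1 h1
      (fun j => by simpa only [mul_assoc] using h2 j) ((1 + δ) * Real.log k)
    rwa [Real.rpow_def_of_pos (by exact_mod_cast hk), mul_neg, mul_comm (Real.log k)]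
  filter_upwards [ae_eventually_notMem_of_summable
    (Real.summable_nat_rpow.2 (by linarith)) hE] with ω hω hV
  refine eventually_le_phi_of_blocks hs hδ hV ?_
  filter_upwards [hω] with k hk t
  by_contra! h
  exact hk ⟨t, h⟩

end Noise

/-! ### Growth of φ, and the drift when the largest is served -/

theorem eventually_sqrt_le_phi : ∀ᶠ t : ℕ in atTop, √(t : ℝ) ≤ phi t := by
  have h : Tendsto (fun t : ℕ => Real.log (Real.log t)) atTop atTop :=
    Real.tendsto_log_atTop.comp (Real.tendsto_log_atTop.comp tendsto_natCast_atTop_atTop)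
  filter_upwards [h.eventually_ge_atTop 1] with t ht
  refine Real.sqrt_le_sqrt ?_
  have : (0 : ℝ) ≤ t := Nat.cast_nonneg t
  nlinarith

theorem eventually_log_le_mul_phi {ε : ℝ} (hε : 0 < ε) :
    ∀ᶠ t : ℕ in atTop, Real.log (t + 1) ≤ ε * phi t := by
  have h := ((isLittleO_log_rpow_atTop (r := 1 / 2) (by norm_num)).comp_tendsto
    (tendsto_natCast_atTop_atTop (R := ℝ))).bound (by positivity : 0 < ε / 2)
  have hl : ∀ᶠ t : ℕ in atTop, Real.log 2 ≤ ε / 2 * √(t : ℝ) :=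
    ((Real.tendsto_sqrt_atTop.comp tendsto_natCast_atTop_atTop).const_mul_atTop
      (by positivity : 0 < ε / 2)).eventually_ge_atTop _
  filter_upwards [h, hl, eventually_sqrt_le_phi, eventually_ge_atTop 1] with t h1 h2 h3 ht
  have ht' : (1 : ℝ) ≤ t := by exact_mod_cast ht
  simp only [Function.comp_apply, ← Real.sqrt_eq_rpow, Real.norm_eq_abs,
    abs_of_nonneg (Real.sqrt_nonneg _)] at h1
  have h4 : Real.log (t + 1) ≤ Real.log 2 + Real.log t := by
    rw [← Real.log_mul (by norm_num) (by positivity)]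
    exact Real.log_le_log (by positivity) (by linarith)
  have h5 := le_abs_self (Real.log t)
  nlinarith

theorem eventually_phi_le_mul {ε : ℝ} (hε : 0 < ε) : ∀ᶠ t : ℕ in atTop, phi t ≤ ε * t := by
  have h := (Real.isLittleO_log_id_atTop.comp_tendsto
    (tendsto_natCast_atTop_atTop (R := ℝ))).bound (by positivity : 0 < ε ^ 2 / 2)
  filter_upwards [h] with t h1
  have ht : (0 : ℝ) ≤ t := Nat.cast_nonneg t
  simp only [Function.comp_apply, id, Real.norm_eq_abs, abs_of_nonneg ht,
    abs_of_nonneg (Real.log_natCast_nonneg t)] at h1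
  refine Real.sqrt_le_iff.2 ⟨by positivity, ?_⟩
  have h2 := Real.log_le_self (Real.log_natCast_nonneg t)
  calc 2 * (t : ℝ) * Real.log (Real.log t) ≤ 2 * t * (ε ^ 2 / 2 * t) := by
        gcongr
        exact h2.trans h1
    _ = (ε * t) ^ 2 := by ring

/-- Serving the largest of `N` positive numbers decreases their sum. -/
theorem sum_mul_sub_ite_le {N : ℕ} {r E : Fin N → ℝ} {ρ : ℝ} (hρ : 0 ≤ ρ) (hr : ∀ k, ρ ≤ r k)
    (hsum : ∑ k, r k = 1) {i s : Fin N} (hmax : ∀ k, E k ≤ E s) (hi : E i ≤ 1) :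
    ∑ k, E k * (r k - if s = k then 1 else 0) ≤ ρ * (1 - (∑ k, E k) / N) := by
  have hN : (0 : ℝ) < N := by exact_mod_cast s.pos
  have h1 : ∑ k, E k * (r k - if s = k then 1 else 0) = ∑ k, r k * (E k - E s) := by
    simp only [mul_sub, Finset.sum_sub_distrib, ← Finset.sum_mul, hsum, mul_ite, mul_one,
      mul_zero, Finset.sum_ite_eq, Finset.mem_univ, if_true, one_mul]
    simp only [mul_comm]
  -- All terms are nonpositive, so only that of i, where E i ≤ 1, is kept; E s is then bounded below
  -- by the average.
  have h2 : ∑ k, r k * (E k - E s) ≤ r i * (E i - E s) := by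
    rw [← Finset.add_sum_erase _ _ (Finset.mem_univ i)]
    refine add_le_of_nonpos_right (Finset.sum_nonpos fun k _ => ?_)
    exact mul_nonpos_of_nonneg_of_nonpos (hρ.trans (hr k)) (sub_nonpos.2 (hmax k))
  have h3 : (∑ k, E k) / N ≤ E s := by
    rw [div_le_iff₀ hN]
    calc ∑ k, E k ≤ ∑ _k : Fin N, E s := Finset.sum_le_sum fun k _ => hmax k
      _ = E s * N := by simp [mul_comm]
  have h4 : r i * (E i - E s) ≤ ρ * (E i - E s) :=
    mul_le_mul_of_nonpos_right (hr i) (sub_nonpos.2 (hmax i))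
  rw [h1]
  nlinarith

/-! ### Weighted debts and their excesses -/

section Debt

variable {Ω : Type*} {N : ℕ} {p q : Fin N → ℝ} {served : ℕ → Ω → Fin N} {success : ℕ → Set Ω}

theorem debt_succ (j : Fin N) (t : ℕ) (ω : Ω) :
    debt q served success j (t + 1) ω = debt q served success j t ω + q j -
      if served t ω = j then (success t).indicator (fun _ => (1 : ℝ)) ω else 0 := by
  have : (deliveredTo served success j t).indicator (fun _ => (1 : ℝ)) ω =
      if served t ω = j then (success t).indicator (fun _ => (1 : ℝ)) ω else 0 := by
    by_cases h : served t ω = j <;> by_cases h' : ω ∈ success t <;>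
      simp [deliveredTo, Set.indicator, h, h']
  rw [debt, debt, Finset.sum_range_succ, this]
  push_cast
  ring

/-- The weighted requirements add up to exactly the one attempt made per slot, whoever is served;
only the channel noise remains. -/
theorem sum_debt_div (hsum : ∑ j, q j / p j = 1) (t : ℕ) (ω : Ω) :
    ∑ k, debt q served success k t ω / p k = noiseSum p served success (fun _ => 1) t ω := by
  induction t with
  | zero => simp [debt, noiseSum]
  | succ t ih =>
    simp only [debt_succ, sub_div, add_div, Finset.sum_sub_distrib, Finset.sum_add_distrib, ih,
      hsum, noiseSum, Finset.sum_range_succ, ite_div, zero_div, Finset.sum_ite_eq,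
      Finset.mem_univ, if_true, noise]
    ring

/-- The number of slots before `t` in which client `j` is served. -/
noncomputable def attempts (served : ℕ → Ω → Fin N) (j : Fin N) (t : ℕ) (ω : Ω) : ℝ :=
  ∑ l ∈ Finset.range t, if served l ω = j then 1 else 0

theorem debt_div_eq (j : Fin N) (t : ℕ) (ω : Ω) :
    debt q served success j t ω / p j = t * (q j / p j) - attempts served j t ω +
      noiseSum p served success (fun k => if k = j then 1 else 0) t ω := by
  induction t with
  | zero => simp [debt, noiseSum, attempts]
  | succ t ih =>
    rw [debt_succ, sub_div, add_div, ih]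
    simp only [noiseSum, attempts, Finset.sum_range_succ, noise]
    push_cast
    by_cases h : served t ω = j
    · simp only [h, if_true]; ring
    · simp only [h, if_false]; ring

/-- Reduces the variance of the total to the shares of slots. -/
theorem noiseVar_one_eq (t : ℕ) (ω : Ω) :
    noiseVar p served (fun _ => 1) t ω = ∑ j, attempts served j t ω * ((1 - p j) / p j) := by
  simp only [noiseVar, attempts, Finset.sum_mul]
  rw [Finset.sum_comm]
  simp [ite_mul]

/-- The excess of the weighted debt of client `j` over the average weighted debt. -/
noncomputable def excess (p q : Fin N → ℝ) (served : ℕ → Ω → Fin N) (success : ℕ → Set Ω)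
    (j : Fin N) (t : ℕ) (ω : Ω) : ℝ :=
  debt q served success j t ω / p j - noiseSum p served success (fun _ => 1) t ω / N

/-- The increment of the excess of client `j` in a slot in which client `s` is served, with
success for `b = 1` and without for `b = 0`. -/
noncomputable def excessStep (p q : Fin N → ℝ) (b : ℝ) (j s : Fin N) : ℝ :=
  q j / p j - (if s = j then b / p j else 0) - (1 - b / p s) / N

theorem excess_succ (j : Fin N) (t : ℕ) (ω : Ω) :
    excess p q served success j (t + 1) ω = excess p q served success j t ω +
      excessStep p q ((success t).indicator (fun _ => (1 : ℝ)) ω) j (served t ω) := by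
  simp only [excess, excessStep, debt_succ, noiseSum, Finset.sum_range_succ, noise, sub_div,
    add_div, ite_div, zero_div]
  ring

/-- Averaging over the channel removes the common noise and leaves the drift treated in
`sum_mul_sub_ite_le`. -/
theorem excessStep_mean (hp : ∀ j, 0 < p j) (j s : Fin N) :
    p s * excessStep p q 1 j s + (1 - p s) * excessStep p q 0 j s =
      q j / p j - if s = j then 1 else 0 := by
  have := (hp s).ne'
  unfold excessStep
  by_cases h : s = j
  · subst h
    simp only [if_true]
    field_simp
    ring
  · simp only [h, if_false]
    field_simp
    ring

/-- Guarantees a client with nonpositive excess, and turns upper bounds for all excesses into lower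
bounds. -/
theorem sum_excess (hsum : ∑ j, q j / p j = 1) (t : ℕ) (ω : Ω) :
    ∑ j, excess p q served success j t ω = 0 := by
  have hN : (N : ℝ) ≠ 0 := by
    rintro h
    obtain rfl : N = 0 := by exact_mod_cast h
    simp at hsum
  simp only [excess, Finset.sum_sub_distrib, sum_debt_div hsum, Finset.sum_const,
    Finset.card_univ, Fintype.card_fin, nsmul_eq_mul]
  field_simp
  ring

theorem IsMWDF.excess_le (mwdf : IsMWDF p q served success) (t : ℕ) (ω : Ω) (k : Fin N) :
    excess p q served success k t ω ≤ excess p q served success (served t ω) t ω :=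
  sub_le_sub_right (mwdf t ω k) _

/-- The exponential Lyapunov function of the excesses. -/
noncomputable def excessExp (p q : Fin N → ℝ) (served : ℕ → Ω → Fin N) (success : ℕ → Set Ω)
    (η : ℝ) (t : ℕ) (ω : Ω) : ℝ :=
  ∑ j, Real.exp (η * excess p q served success j t ω)

/-! ### State-space collapse under MWDF -/

variable [mΩ : MeasurableSpace Ω] {μ : Measure Ω} {ℱ : Filtration ℕ mΩ}

theorem IsSlottedNetwork.measurable_excess (network : IsSlottedNetwork μ ℱ p served success)
    (j : Fin N) (t : ℕ) : Measurable[ℱ t] (excess p q served success j t) := by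
  refine Measurable.sub (Measurable.div_const ?_ _)
    ((network.measurable_noiseSum _ t).div_const _)
  refine measurable_const.sub (Finset.measurable_fun_sum _ fun l hl => ?_)
  have hl : l + 1 ≤ t := Finset.mem_range.1 hl
  refine measurable_const.indicator (MeasurableSet.inter ?_
    (ℱ.mono hl _ (network.success_measurable l)))
  exact ℱ.mono (by omega) _ (network.served_measurable l (MeasurableSet.singleton j))

variable [IsProbabilityMeasure μ]

/-- Under the MWDF policy the exponential moments of the excesses are bounded. -/
theorem IsSlottedNetwork.exists_integral_excessExp_le
    (network : IsSlottedNetwork μ ℱ p served success) (mwdf : IsMWDF p q served success)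
    (hp : ∀ j, 0 < p j) (hq : ∀ j, 0 < q j)
    (hsum : ∑ j, q j / p j = 1) :
    ∃ η > 0, ∀ t, Integrable (excessExp p q served success η t) μ ∧
      ∫ ω, excessExp p q served success η t ω ∂μ ≤ 2 * N := by
  have hne : Nonempty (Fin N) := by
    by_contra h
    rw [not_nonempty_iff] at h
    simp at hsum
  have hN : (1 : ℝ) ≤ N := by exact_mod_cast (Fin.pos hne.some)
  obtain ⟨i, hi⟩ := Finite.exists_min fun j => q j / p j
  set ρ := q i / p i with hρ
  have hρ0 : 0 < ρ := div_pos (hq i) (hp i)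
  have hρ1 : ρ ≤ 1 := hsum ▸ Finset.single_le_sum (f := fun j => q j / p j)
    (fun j _ => (div_pos (hq j) (hp j)).le) (Finset.mem_univ i)
  set D := 1 + ∑ j, ∑ s, (|excessStep p q 1 j s| + |excessStep p q 0 j s|) with hD
  have hD1 : 1 ≤ D := le_add_of_nonneg_right (by positivity)
  have hstep : ∀ (A : Set Ω) ω j s,
      |excessStep p q (A.indicator (fun _ => (1 : ℝ)) ω) j s| ≤ D := by
    intro A ω j s
    have h1 : |excessStep p q 1 j s| + |excessStep p q 0 j s| ≤ D :=
      calc _ ≤ ∑ s, (|excessStep p q 1 j s| + |excessStep p q 0 j s|) :=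
            Finset.single_le_sum (f := fun s => |excessStep p q 1 j s| + |excessStep p q 0 j s|)
              (fun _ _ => by positivity) (Finset.mem_univ s)
        _ ≤ ∑ j, ∑ s, (|excessStep p q 1 j s| + |excessStep p q 0 j s|) :=
            Finset.single_le_sum
              (f := fun j => ∑ s, (|excessStep p q 1 j s| + |excessStep p q 0 j s|))
              (fun _ _ => by positivity) (Finset.mem_univ j)
        _ ≤ D := by rw [hD]; linarith
    have h2 := abs_nonneg (excessStep p q 1 j s)
    have h3 := abs_nonneg (excessStep p q 0 j s)
    by_cases h : ω ∈ A
    · rw [Set.indicator_of_mem h]; linarith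
    · rw [Set.indicator_of_notMem h]; linarith
  -- With this η the second-order error η² D² is exactly half of the drift coefficient ηρ/N, and η D
  -- ≤ 1.
  set η := ρ / (2 * N * D ^ 2) with hη
  have hη0 : 0 < η := by positivity
  have hηD : η * D ≤ 1 := by
    rw [hη, div_mul_eq_mul_div, div_le_one (by positivity)]
    calc ρ * D ≤ N * D := mul_le_mul_of_nonneg_right (hρ1.trans hN) (by positivity)
      _ ≤ 2 * N * D ^ 2 := by
        have : D ≤ D ^ 2 := le_self_pow₀ hD1 two_ne_zero
        nlinarith
  have hηD2 : η ^ 2 * D ^ 2 = η * ρ / (2 * N) := by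
    rw [hη]
    field_simp
  have hκ1 : η * ρ / (2 * N) ≤ 1 := by
    rw [← hηD2, ← mul_pow]
    exact pow_le_one₀ (by positivity) hηD
  have hmul : ∀ t ω j, Real.exp (η * excess p q served success j (t + 1) ω) =
      Real.exp (η * excess p q served success j t ω) * Real.exp (η *
        excessStep p q ((success t).indicator (fun _ => (1 : ℝ)) ω) j (served t ω)) := by
    intro t ω j
    rw [excess_succ, ← Real.exp_add, mul_add]
  have hEm : ∀ j t, Measurable[ℱ t] fun ω => Real.exp (η * excess p q served success j t ω) :=
    fun j t => Real.measurable_exp.comp ((network.measurable_excess j t).const_mul η)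
  have hEi : ∀ j t, Integrable (fun ω => Real.exp (η * excess p q served success j t ω)) μ := by
    intro j t
    induction t with
    | zero => simp [excess, debt, noiseSum]
    | succ t ih =>
      refine (ih.mul_const (Real.exp (η * D))).mono'
        ((hEm j (t + 1)).mono (ℱ.le _) le_rfl).aestronglyMeasurable (.of_forall fun ω => ?_)
      rw [Real.norm_of_nonneg (Real.exp_nonneg _), hmul]
      gcongr
      exact (le_abs_self _).trans (hstep _ ω _ _)
  have hΦi : ∀ t, Integrable (excessExp p q served success η t) μ := fun t =>
    integrable_finsetSum _ fun j _ => hEi j t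
  -- From exp y ≤ 1 + y + y² for |y| ≤ 1; being affine in the increment, it averages through
  -- `excessStep_mean`.
  set F : ℝ → ℕ → Ω → ℝ := fun b t ω => ∑ j, Real.exp (η * excess p q served success j t ω) *
    (1 + η ^ 2 * D ^ 2 + η * excessStep p q b j (served t ω)) with hF
  have hFm : ∀ b t, Measurable[ℱ t] (F b t) := fun b t =>
    Finset.measurable_fun_sum _ fun j _ => (hEm j t).mul (network.measurable_comp_served t
      fun s => 1 + η ^ 2 * D ^ 2 + η * excessStep p q b j s)
  have hFi : ∀ b t, Integrable (F b t) μ := fun b t =>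
    integrable_finsetSum _ fun j _ => (hEi j t).mul_bdd
      (network.integrable_comp_served t
        fun s => 1 + η ^ 2 * D ^ 2 + η * excessStep p q b j s).aestronglyMeasurable
      (.of_forall fun ω => Finset.single_le_sum
        (f := fun s => ‖1 + η ^ 2 * D ^ 2 + η * excessStep p q b j s‖)
        (fun _ _ => norm_nonneg _) (Finset.mem_univ (served t ω)))
  have hle : ∀ t ω, excessExp p q served success η (t + 1) ω ≤
      F ((success t).indicator (fun _ => (1 : ℝ)) ω) t ω := by
    intro t ω
    refine Finset.sum_le_sum fun j _ => ?_
    rw [hmul]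
    refine mul_le_mul_of_nonneg_left ?_ (Real.exp_nonneg _)
    set x := excessStep p q ((success t).indicator (fun _ => (1 : ℝ)) ω) j (served t ω)
    have hx : |x| ≤ D := hstep _ ω _ _
    have h1 : |η * x| ≤ 1 := by
      rw [abs_mul, abs_of_pos hη0]
      exact (mul_le_mul_of_nonneg_left hx hη0.le).trans hηD
    have h2 := le_of_abs_le (Real.abs_exp_sub_one_sub_id_le h1)
    have h3 : (η * x) ^ 2 ≤ η ^ 2 * D ^ 2 := by
      rw [mul_pow]
      exact mul_le_mul_of_nonneg_left (sq_le_sq' (abs_le.1 hx).1 (abs_le.1 hx).2) (sq_nonneg η)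
    linarith
  have hdrift : ∀ t ω, p (served t ω) * F 1 t ω + (1 - p (served t ω)) * F 0 t ω ≤
      (1 - η * ρ / (2 * N)) * excessExp p q served success η t ω + η * ρ := by
    intro t ω
    set s := served t ω with hs
    have hEs : ∀ k, Real.exp (η * excess p q served success k t ω) ≤
        Real.exp (η * excess p q served success s t ω) := fun k =>
      Real.exp_le_exp.2 (mul_le_mul_of_nonneg_left (mwdf.excess_le t ω k) hη0.le)
    have hzero := sum_excess (served := served) (success := success) hsum t ω
    obtain ⟨k, -, hk⟩ := Finset.exists_le_of_sum_le (f := fun j => excess p q served success j t ω)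
      (g := fun _ => (0 : ℝ)) (Finset.univ_nonempty (α := Fin N)) (by simpa using hzero.le)
    have h1 := sum_mul_sub_ite_le hρ0.le hi hsum hEs
      (Real.exp_le_one_iff.2 (mul_nonpos_of_nonneg_of_nonpos hη0.le hk))
    have h2 : p s * F 1 t ω + (1 - p s) * F 0 t ω =
        (1 + η ^ 2 * D ^ 2) * excessExp p q served success η t ω +
        η * ∑ k, Real.exp (η * excess p q served success k t ω) *
          (q k / p k - if s = k then 1 else 0) := by
      simp only [hF, excessExp, Finset.mul_sum, ← Finset.sum_add_distrib, ← hs,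
        ← excessStep_mean hp]
      refine Finset.sum_congr rfl fun j _ => ?_
      ring
    have h3 := mul_le_mul_of_nonneg_left h1 hη0.le
    have h4 : η * (ρ * (1 - excessExp p q served success η t ω / N)) =
        η * ρ - 2 * (η * ρ / (2 * N)) * excessExp p q served success η t ω := by
      field_simp
    have h5 : (∑ k, Real.exp (η * excess p q served success k t ω)) =
      excessExp p q served success η t ω := rfl
    rw [h5] at h3
    rw [h2, hηD2]
    linarith
  refine ⟨η, hη0, fun t => ⟨hΦi t, ?_⟩⟩
  -- The bound 2N is the fixed point of x ↦ (1 - ηρ/(2N)) x + ηρ, and the initial value is N.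
  induction t with
  | zero =>
    simp only [excessExp, excess, debt, noiseSum]
    simp
    linarith
  | succ t ih =>
    have h := network.setIntegral_le_of_step t (hFm 0 t) (hFm 1 t) (hΦi (t + 1)) (hFi 0 t)
      (hFi 1 t) (((hΦi t).const_mul (1 - η * ρ / (2 * N))).add (integrable_const (η * ρ)))
      (fun ω h => by simpa [Set.indicator_of_mem h] using hle t ω)
      (fun ω h => by simpa [Set.indicator_of_notMem h] using hle t ω) (hdrift t)
      MeasurableSet.univ
    simp only [Measure.restrict_univ] at h
    refine h.trans ?_
    rw [integral_add' ((hΦi t).const_mul _) (integrable_const _), integral_const_mul]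
    simp only [integral_const, probReal_univ, one_smul]
    calc (1 - η * ρ / (2 * N)) * ∫ ω, excessExp p q served success η t ω ∂μ + η * ρ
        ≤ (1 - η * ρ / (2 * N)) * (2 * N) + η * ρ := by
          have := sub_nonneg.2 hκ1
          gcongr
      _ = 2 * N := by field_simp; ring

/-- State-space collapse: under the MWDF policy the weighted debts exceed their average by
`o(φ(t))` only. -/
theorem IsSlottedNetwork.ae_eventually_excess_le
    (network : IsSlottedNetwork μ ℱ p served success) (mwdf : IsMWDF p q served success)
    (hp : ∀ j, 0 < p j) (hq : ∀ j, 0 < q j)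
    (hsum : ∑ j, q j / p j = 1) :
    ∀ᵐ ω ∂μ, ∀ ε > 0, ∀ᶠ t : ℕ in atTop, ∀ j, excess p q served success j t ω ≤ ε * phi t := by
  obtain ⟨η, hη, hΦ⟩ := network.exists_integral_excessExp_le mwdf hp hq hsum
  have hsummable : Summable fun t : ℕ => 2 * (N : ℝ) * (1 / ((t + 1 : ℕ) : ℝ) ^ 2) :=
    ((summable_nat_add_iff 1).2 (Real.summable_one_div_nat_pow.2 one_lt_two)).mul_left _
  -- Markov's inequality at the summable level (t + 1)²; off these events the excess is at most
  -- (2/η) log(t + 1).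
  have hE : ∀ t : ℕ, μ {ω | ((t + 1 : ℕ) : ℝ) ^ 2 ≤ excessExp p q served success η t ω} ≤
      ENNReal.ofReal (2 * (N : ℝ) * (1 / ((t + 1 : ℕ) : ℝ) ^ 2)) := by
    intro t
    rw [← ofReal_measureReal]
    refine ENNReal.ofReal_le_ofReal ?_
    have h := mul_meas_ge_le_integral_of_nonneg (μ := μ) (.of_forall fun ω =>
      Finset.sum_nonneg fun j _ => (Real.exp_pos _).le) (hΦ t).1 (((t + 1 : ℕ) : ℝ) ^ 2)
    rw [mul_one_div, le_div_iff₀ (by positivity), mul_comm]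
    exact h.trans (hΦ t).2
  filter_upwards [ae_eventually_notMem_of_summable hsummable (.of_forall hE)] with ω hω ε hε
  filter_upwards [hω, eventually_log_le_mul_phi (by positivity : 0 < ε * η / 2)] with t h1 h2 j
  have h3 : Real.exp (η * excess p q served success j t ω) ≤ ((t + 1 : ℕ) : ℝ) ^ 2 :=
    (Finset.single_le_sum (f := fun j => Real.exp (η * excess p q served success j t ω))
      (fun _ _ => (Real.exp_pos _).le) (Finset.mem_univ j)).trans (not_le.1 h1).le
  have h4 := (Real.le_log_iff_exp_le (by positivity)).2 h3
  rw [Real.log_pow] at h4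
  push_cast at h4
  have h5 : η * excess p q served success j t ω ≤ η * (ε * phi t) := by linarith
  exact le_of_mul_le_mul_left h5 hη

/-! ### Shares of slots and the total debt -/

/-- The variance is trivially O(t), so the noise is O(φ) = o(t). No knowledge of the shares is
needed, which avoids circularity. -/
theorem IsSlottedNetwork.ae_eventually_noiseSum_le_mul
    (network : IsSlottedNetwork μ ℱ p served success)
    (hp : ∀ j, 0 < p j) (hp1 : ∀ j, p j ≤ 1) (a : Fin N → ℝ) :
    ∀ᵐ ω ∂μ, ∀ ε > 0, ∀ᶠ t : ℕ in atTop, noiseSum p served success a t ω ≤ ε * t := by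
  have hnn : ∀ k, 0 ≤ a k ^ 2 * ((1 - p k) / p k) := fun k =>
    mul_nonneg (sq_nonneg _) (div_nonneg (sub_nonneg.2 (hp1 k)) (hp k).le)
  -- The summand 1 keeps v positive even when every channel is perfect.
  set v := 1 + ∑ k, a k ^ 2 * ((1 - p k) / p k) with hv
  have hv0 : 0 < v := add_pos_of_pos_of_nonneg one_pos (Finset.sum_nonneg fun k _ => hnn k)
  filter_upwards [network.ae_eventually_noiseSum_le hp hp1 a (Real.sqrt_pos.2 hv0) one_pos le_rfl]
    with ω hω ε hε
  have hs := Real.sqrt_pos.2 hv0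
  have hV : ∀ t : ℕ, noiseVar p served a t ω ≤ √v ^ 2 * t := by
    intro t
    rw [Real.sq_sqrt hv0.le]
    calc noiseVar p served a t ω ≤ ∑ _l ∈ Finset.range t, v := by
          refine Finset.sum_le_sum fun l _ => ?_
          have := Finset.single_le_sum (f := fun k => a k ^ 2 * ((1 - p k) / p k))
            (fun k _ => hnn k) (Finset.mem_univ (served l ω))
          linarith
      _ = v * t := by simp [mul_comm]
  filter_upwards [hω (.of_forall hV),
    eventually_phi_le_mul (by positivity : 0 < ε / ((1 + 1) ^ 3 * √v))] with t h1 h2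
  refine h1.trans ((mul_le_mul_of_nonneg_left h2 (by positivity)).trans_eq ?_)
  field_simp

/-- Under the MWDF policy every client gets at most its share of the slots. -/
theorem IsSlottedNetwork.ae_eventually_attempts_le
    (network : IsSlottedNetwork μ ℱ p served success) (mwdf : IsMWDF p q served success)
    (hp : ∀ j, 0 < p j) (hp1 : ∀ j, p j ≤ 1) (hq : ∀ j, 0 < q j)
    (hsum : ∑ j, q j / p j = 1) :
    ∀ᵐ ω ∂μ, ∀ ε > 0, ∀ᶠ t : ℕ in atTop, ∀ j,
      attempts served j t ω ≤ (q j / p j + ε) * t := by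
  filter_upwards [network.ae_eventually_excess_le mwdf hp hq hsum,
    -- The weight -1 gives the lower bound for the total noise.
    network.ae_eventually_noiseSum_le_mul hp hp1 fun _ => -1,
    ae_all_iff.2 fun j : Fin N =>
      network.ae_eventually_noiseSum_le_mul hp hp1 fun k => if k = j then 1 else 0]
    with ω h1 h2 h3 ε hε
  rcases Nat.eq_zero_or_pos N with rfl | hNpos
  · simp at hsum
  have hN : (1 : ℝ) ≤ N := by exact_mod_cast hNpos
  filter_upwards [h1 (1 / N) (by positivity), h2 (ε / 3) (by positivity),
    eventually_all.2 fun j => h3 j (ε / 3) (by positivity),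
    eventually_phi_le_mul (by positivity : 0 < ε / 3)] with t e1 e2 e3 e4 j
  have ht : (0 : ℝ) ≤ t := Nat.cast_nonneg t
  have hφ : 0 ≤ phi t := Real.sqrt_nonneg _
  have hneg : noiseSum p served success (fun _ => -1) t ω =
      -noiseSum p served success (fun _ => 1) t ω := by
    simp [noiseSum]
  -- The excesses sum to zero and each is at most φ/N.
  have hexc : -phi t ≤ excess p q served success j t ω := by
    have h0 := sum_excess (served := served) (success := success) hsum t ω
    rw [← Finset.add_sum_erase _ _ (Finset.mem_univ j)] at h0
    have h5 : ∑ i ∈ Finset.univ.erase j, excess p q served success i t ω ≤ phi t :=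
      calc ∑ i ∈ Finset.univ.erase j, excess p q served success i t ω
          ≤ ∑ _i ∈ Finset.univ.erase j, 1 / N * phi t := Finset.sum_le_sum fun i _ => e1 i
        _ ≤ ∑ _i : Fin N, 1 / N * phi t :=
            Finset.sum_le_sum_of_subset_of_nonneg (Finset.erase_subset _ _)
              fun _ _ _ => by positivity
        _ = phi t := by
            simp only [Finset.sum_const, Finset.card_univ, Fintype.card_fin, nsmul_eq_mul]
            field_simp
    linarith
  have hS : -(ε / 3 * t) ≤ noiseSum p served success (fun _ => 1) t ω / N := by
    rw [le_div_iff₀ (by positivity)]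
    have : 0 ≤ ε / 3 * t := by positivity
    nlinarith
  have hdiv := debt_div_eq (p := p) (q := q) (served := served) (success := success) j t ω
  have e3j := e3 j
  rw [excess, hdiv] at hexc
  linarith

/-- The law of the iterated logarithm for the sum of the weighted debts. -/
theorem IsSlottedNetwork.ae_eventually_total_le
    (network : IsSlottedNetwork μ ℱ p served success) (mwdf : IsMWDF p q served success)
    (hp : ∀ j, 0 < p j) (hp1 : ∀ j, p j ≤ 1) (hq : ∀ j, 0 < q j)
    (hsum : ∑ j, q j / p j = 1) {x : ℝ} (hx : √(∑ k, lilConst (p k) (q k)) < x) :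
    ∀ᵐ ω ∂μ, ∀ᶠ t : ℕ in atTop, noiseSum p served success (fun _ => 1) t ω ≤ x * phi t := by
  set σ := √(∑ k, lilConst (p k) (q k)) with hσ
  have hc : 0 ≤ ∑ k, lilConst (p k) (q k) := Finset.sum_nonneg fun k _ =>
    div_nonneg (mul_nonneg (hq k).le (sub_nonneg.2 (hp1 k))) (sq_nonneg _)
  have hσ0 : 0 ≤ σ := Real.sqrt_nonneg _
  have hσ2 : σ ^ 2 = ∑ k, lilConst (p k) (q k) := Real.sq_sqrt hc
  obtain ⟨s, hσs, hsx⟩ := exists_between hx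
  have hs : 0 < s := hσ0.trans_lt hσs
  obtain ⟨δ, hδ0, hδ1, hδ⟩ : ∃ δ : ℝ, 0 < δ ∧ δ ≤ 1 ∧ (1 + δ) ^ 3 * s ≤ x := by
    -- The 7 comes from (1 + δ)³ ≤ 1 + 7δ on [0, 1].
    refine ⟨min 1 ((x - s) / (7 * s)), lt_min one_pos (div_pos (sub_pos.2 hsx) (by positivity)),
      min_le_left _ _, ?_⟩
    set δ := min 1 ((x - s) / (7 * s)) with hδ
    have h0 : 0 < δ := lt_min one_pos (div_pos (sub_pos.2 hsx) (by positivity))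
    have h1 : δ ≤ 1 := min_le_left _ _
    have h2 : δ * (7 * s) ≤ x - s := (le_div_iff₀ (by positivity)).1 (min_le_right _ _)
    have h3 : (1 + δ) ^ 3 ≤ 1 + 7 * δ := by nlinarith [mul_nonneg h0.le (sub_nonneg.2 h1)]
    nlinarith
  have hR : 0 ≤ ∑ k, (1 - p k) / p k := Finset.sum_nonneg fun k _ =>
    div_nonneg (sub_nonneg.2 (hp1 k)) (hp k).le
  filter_upwards [network.ae_eventually_attempts_le mwdf hp hp1 hq hsum,
    network.ae_eventually_noiseSum_le hp hp1 (fun _ => 1) hs hδ0 hδ1] with ω h1 h2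
  have hgap : 0 < s ^ 2 - σ ^ 2 := by nlinarith
  refine (h2 ?_).mono fun t ht => ht.trans
    (mul_le_mul_of_nonneg_right hδ (Real.sqrt_nonneg _))
  -- This error in the shares adds at most s² - σ² to the variance rate.
  filter_upwards [h1 ((s ^ 2 - σ ^ 2) / (1 + ∑ k, (1 - p k) / p k)) (by positivity)] with t ht
  set ε := (s ^ 2 - σ ^ 2) / (1 + ∑ k, (1 - p k) / p k) with hε
  have hε0 : 0 < ε := by positivity
  have hεR : ε * ∑ k, (1 - p k) / p k ≤ s ^ 2 - σ ^ 2 := by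
    rw [hε, div_mul_eq_mul_div, div_le_iff₀ (by positivity)]
    nlinarith
  rw [noiseVar_one_eq]
  calc ∑ j, attempts served j t ω * ((1 - p j) / p j)
      ≤ ∑ j, (q j / p j + ε) * t * ((1 - p j) / p j) := Finset.sum_le_sum fun j _ =>
        mul_le_mul_of_nonneg_right (ht j) (div_nonneg (sub_nonneg.2 (hp1 j)) (hp j).le)
    _ = (σ ^ 2 + ε * ∑ k, (1 - p k) / p k) * t := by
        rw [hσ2, Finset.mul_sum, ← Finset.sum_add_distrib, Finset.sum_mul]
        refine Finset.sum_congr rfl fun j _ => ?_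
        have := (hp j).ne'
        rw [lilConst]
        field_simp
    _ ≤ s ^ 2 * t := by
        gcongr
        linarith

end Debt

/-! ### Conclusion -/

theorem sqrt_sum_le_sum_sqrt {ι : Type*} (s : Finset ι) {f : ι → ℝ} (hf : ∀ i, 0 ≤ f i) :
    √(∑ i ∈ s, f i) ≤ ∑ i ∈ s, √(f i) := by
  refine Real.sqrt_le_iff.2 ⟨Finset.sum_nonneg fun i _ => Real.sqrt_nonneg _, ?_⟩
  calc ∑ i ∈ s, f i = ∑ i ∈ s, √(f i) ^ 2 :=
        Finset.sum_congr rfl fun i _ => (Real.sq_sqrt (hf i)).symm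
    _ ≤ (∑ i ∈ s, √(f i)) ^ 2 := Finset.sum_sq_le_sq_sum_of_nonneg fun i _ => Real.sqrt_nonneg _

theorem mainTheorem4 {Ω : Type*} [mΩ : MeasurableSpace Ω] (μ : Measure Ω)
    [IsProbabilityMeasure μ] (ℱ : Filtration ℕ mΩ) (N : ℕ) (p q : Fin N → ℝ)
    (hp_pos : ∀ j, 0 < p j) (hp_le : ∀ j, p j ≤ 1) (hq_pos : ∀ j, 0 < q j)
    (hyperplane : ∑ j, q j / p j = 1)
    (served : ℕ → Ω → Fin N) (success : ℕ → Set Ω)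
    (network : IsSlottedNetwork μ ℱ p served success)
    (mwdf : IsMWDF p q served success) :
    ∀ᵐ ω ∂μ, ∀ j : Fin N,
      limsup (fun t : ℕ => ((debt q served success j t ω / phi t : ℝ) : EReal)) atTop ≤
        ((p j * ((∑ k, Real.sqrt (lilConst (p k) (q k))) / (N : ℝ)) : ℝ) : EReal) := by
  set σ := √(∑ k, lilConst (p k) (q k)) with hσ
  have hσle : σ ≤ ∑ k, √(lilConst (p k) (q k)) := sqrt_sum_le_sum_sqrt _ fun k =>
    div_nonneg (mul_nonneg (hq_pos k).le (sub_nonneg.2 (hp_le k))) (sq_nonneg _)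
  filter_upwards [network.ae_eventually_excess_le mwdf hp_pos hq_pos hyperplane,
    -- Countably many levels above σ, so that one null set serves all of them.
    ae_all_iff.2 fun n : ℕ => network.ae_eventually_total_le mwdf hp_pos hp_le hq_pos hyperplane
      (x := σ + 1 / (n + 1)) (lt_add_of_pos_right _ (by positivity))] with ω h1 h2 j
  have hN : (1 : ℝ) ≤ N := by exact_mod_cast j.pos
  refine EReal.le_of_forall_lt_iff_le.1 fun z hz => ?_
  rw [EReal.coe_lt_coe_iff] at hz
  -- Half the gap suffices: the error p_j (ε + ε/N) is at most 2ε.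
  obtain ⟨n, hn⟩ := exists_nat_one_div_lt (half_pos (sub_pos.2 hz))
  set ε : ℝ := 1 / (n + 1) with hε
  have hε0 : 0 < ε := by positivity
  refine limsup_le_of_le ?_ ?_
  · isBoundedDefault
  filter_upwards [h1 ε hε0, h2 n, eventually_sqrt_le_phi, eventually_gt_atTop 0]
    with t e1 e2 e3 ht
  have hφ : 0 < phi t := (Real.sqrt_pos.2 (by exact_mod_cast ht)).trans_le e3
  rw [EReal.coe_le_coe_iff, div_le_iff₀ hφ]
  have hd : debt q served success j t ω = p j * (excess p q served success j t ω +
      noiseSum p served success (fun _ => 1) t ω / N) := by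
    have := (hp_pos j).ne'
    rw [excess]
    field_simp
    ring
  have hεN : ε / N ≤ ε := div_le_self hε0.le hN
  have hpε : p j * ε ≤ ε := mul_le_of_le_one_left hε0.le (hp_le j)
  have hp := (hp_pos j).le
  calc debt q served success j t ω
      ≤ p j * (ε * phi t + (σ + ε) * phi t / N) := by
        rw [hd]
        gcongr
        exact e1 j
    _ = (p j * (ε + ε / N + σ / N)) * phi t := by ring
    _ ≤ (p j * (ε + ε + (∑ k, √(lilConst (p k) (q k))) / N)) * phi t := by gcongr
    _ ≤ z * phi t := by
        gcongr
        linarith
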